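/- For a set $A$ let $[A]^2$ be the set of two-element subsets of $A$. For a pair-coloring $c:[A]^2\to 2=\{0,1\}$, a set $H\subseteq A$ is $c$-homogeneous if $c$ is constant on $[H]^2$, and the homogeneity number $\mathfrak{hm}(c)$ is the least cardinality of a family of $c$-homogeneous sets that covers $A$. If $X$ is a topological space, $[X]^2$ carries the quotient topology of $X^2\setminus\{(x,x):x\in X\}$ under $(x,y)\sim(y,x)$, and $c:[X]^2\to 2$ is continuous if the preimages of $0$ and $1$ are open. A graph $G$ on $\omega$ is (a copy of) the random graph if it is universal (every graph on $\omega$ embeds into $G$ as an induced subgraph) and homogeneous (every isomorphism between finite induced subgraphs of $G$ extends to an automorphism of $G$); such graphs exist and are unique up to isomorphism. Let $\chi_{\mathrm{random}}:[\omega]^2\to 2$ be the characteristic function of the edge relation of a copy of the random graph on $\omega$. For distinct $x,y\in\omega^\omega$ let $\Delta(x,y)=\min\{n: x(n)\neq y(n)\}$ and $$c_{\mathrm{random}}(x,y)=\chi_{\mathrm{random}}\bigl(x(\Delta(x,y)),\,y(\Delta(x,y))\bigr),$$ and let $c_{\max}$ be the restriction of $c_{\mathrm{random}}$ to $\prod_{n\in\omega}(n+1)=\{x\in\omega^\omega: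 x(n)\le n\text{ for all }n\}$. Then for every choice of the copy of the random graph on $\omega$, for every Polish space $X$ and every continuous $c:[X]^2\to 2$, $$\mathfrak{hm}(c)\le\mathfrak{hm}(c_{\max}).$$ -/

import Mathlib

universe u

/-! ### Pair-colorings -/

/-- `[X]²`, the set of two-element subsets of `X`. -/
def PairSet (X : Type u) : Type u := {p : Sym2 X // ¬ p.IsDiag}

/-- The pair `{x, y}`, for `x ≠ y`. -/
def PairSet.mk {X : Type u} (x y : X) (h : x ≠ y) : PairSet X :=
  ⟨s(x, y), fun hd => h (Sym2.mk_isDiag_iff.mp hd)⟩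

/-- `[X]²` carries the quotient topology of `X² \ {(x, x) : x ∈ X}` under `(x, y) ∼ (y, x)`. -/
instance PairSet.instTopologicalSpace {X : Type u} [TopologicalSpace X] :
    TopologicalSpace (PairSet X) :=
  TopologicalSpace.coinduced
    (fun q : {q : X × X // q.1 ≠ q.2} => PairSet.mk q.1.1 q.1.2 q.2) inferInstance

/-- Pair-colorings `c : [X]² → 2`. Continuity of `c` is `Continuous c`, with `Fin 2` discrete. -/
abbrev PairColoring (X : Type u) : Type u := PairSet X → Fin 2

namespace PairColoring

variable {X : Type u}

/-- The restriction of `c` to (the pairs from) `A ⊆ X`. -/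
def restrict (c : PairColoring X) (A : Set X) : PairColoring A :=
  fun p => c ⟨p.1.map Subtype.val, by
    obtain ⟨p, hp⟩ := p
    induction p using Sym2.ind with
    | _ x y =>
      intro h
      exact hp (Sym2.mk_isDiag_iff.mpr (Subtype.ext (Sym2.mk_isDiag_iff.mp h)))⟩

/-- `H` is `c`-homogeneous: `c` is constant on `[H]²`. -/
def IsHomogeneous (c : PairColoring X) (H : Set X) : Prop :=
  ∃ i : Fin 2, ∀ x ∈ H, ∀ y ∈ H, ∀ h : x ≠ y, c (PairSet.mk x y h) = i

/-- The homogeneity number: the least cardinality of a family of `c`-homogeneous sets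
covering `X`. -/
noncomputable def hm (c : PairColoring X) : Cardinal.{u} :=
  sInf {κ | ∃ F : Set (Set X), (∀ H ∈ F, c.IsHomogeneous H) ∧ ⋃₀ F = Set.univ ∧
    Cardinal.mk F = κ}

/-- The minimum defining `hm c` is attained (singletons are homogeneous and cover `X`). -/
theorem exists_cover_card_eq_hm (c : PairColoring X) :
    ∃ F : Set (Set X), (∀ H ∈ F, c.IsHomogeneous H) ∧ ⋃₀ F = Set.univ ∧
      Cardinal.mk F = c.hm := by
  refine csInf_mem (s := {κ | ∃ F : Set (Set X), (∀ H ∈ F, c.IsHomogeneous H) ∧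
    ⋃₀ F = Set.univ ∧ Cardinal.mk F = κ}) ⟨_, Set.range (fun x : X => {x}), ?_, ?_, rfl⟩
  · rintro _ ⟨a, rfl⟩
    refine ⟨0, fun x hx y hy h => absurd ?_ h⟩
    rw [Set.mem_singleton_iff.mp hx, Set.mem_singleton_iff.mp hy]
  · ext x
    simp

end PairColoring

/-! ### The random graph -/

/-- `G` is universal: every graph on `ω` embeds into `G` as an induced subgraph. -/
def IsUniversalGraph (G : SimpleGraph ℕ) : Prop :=
  ∀ H : SimpleGraph ℕ, Nonempty (H ↪g G)

/-- `G` is homogeneous: every isomorphism between finite induced subgraphs of `G` extends to an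
automorphism of `G`. -/
def IsHomogeneousGraph (G : SimpleGraph ℕ) : Prop :=
  ∀ (A B : Set ℕ), A.Finite → ∀ f : G.induce A ≃g G.induce B,
    ∃ g : G ≃g G, ∀ a : A, g a = f a

/-- `G` is (a copy on `ω` of) the random graph: the homogeneous and universal graph on `ω`,
which is unique up to isomorphism. -/
structure IsRandomGraph (G : SimpleGraph ℕ) : Prop where
  homogeneous : IsHomogeneousGraph G
  universal : IsUniversalGraph G

/-! ### The coloring `c_max` -/

open Classical in
/-- `c_random` on the Baire space: `{x, y}` gets the color of `{x n, y n}` in the random graph,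
where `n = Δ(x, y)` is the least `n` with `x n ≠ y n`. -/
noncomputable def cRandom (G : SimpleGraph ℕ) : PairColoring (ℕ → ℕ) :=
  fun p => Sym2.lift
    ⟨fun x y : ℕ → ℕ =>
        if G.Adj (x (PiNat.firstDiff x y)) (y (PiNat.firstDiff x y)) then (1 : Fin 2) else 0,
      fun x y => by simp only [PiNat.firstDiff_comm x y, G.adj_comm]⟩ p.1

/-- The subspace `∏ₙ (n + 1)` of the Baire space, where `n + 1 = {0, …, n}`. -/
def prodSucc : Set (ℕ → ℕ) := {x | ∀ n, x n < n + 1}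

/-- `c_max`, the restriction of `c_random` to `∏ₙ (n + 1)`. -/
noncomputable def cMax (G : SimpleGraph ℕ) : PairColoring prodSucc :=
  (cRandom G).restrict prodSucc

/-! ### Existence of the random graph -/

namespace RandomGraphExistence

/-- A concrete copy: for `i < j`, `i` and `j` are adjacent iff the `i`-th prime divides `j`. -/
def primeGraph : SimpleGraph ℕ where
  Adj i j := (i < j ∧ Nat.nth Nat.Prime i ∣ j) ∨ (j < i ∧ Nat.nth Nat.Prime j ∣ i)
  symm := ⟨fun _ _ h => h.symm⟩
  loopless := ⟨fun i h => by rcases h with h | h <;> exact lt_irrefl i h.1⟩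

theorem primeGraph_extension (U V : Finset ℕ) (hUV : Disjoint U V) :
    ∃ z, z ∉ U ∧ z ∉ V ∧ (∀ x ∈ U, primeGraph.Adj x z) ∧ ∀ x ∈ V, ¬ primeGraph.Adj x z := by
  classical
  have hp : ∀ n, (Nat.nth Nat.Prime n).Prime := Nat.prime_nth_prime
  obtain ⟨N, hN⟩ : ∃ N, ∀ x ∈ U ∪ V, x < N :=
    ⟨(U ∪ V).sup id + 1, fun x hx => Nat.lt_succ_of_le (Finset.le_sup (f := id) hx)⟩
  have hNz : N < ∏ i ∈ insert N U, Nat.nth Nat.Prime i := by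
    refine lt_of_lt_of_le ?_ (Nat.le_of_dvd (Finset.prod_pos fun i _ => (hp i).pos)
      (Finset.dvd_prod_of_mem _ (Finset.mem_insert_self N U)))
    have := Nat.add_two_le_nth_prime N
    omega
  have hlt : ∀ x ∈ U ∪ V, x < ∏ i ∈ insert N U, Nat.nth Nat.Prime i :=
    fun x hx => (hN x hx).trans hNz
  refine ⟨∏ i ∈ insert N U, Nat.nth Nat.Prime i,
    fun h => lt_irrefl _ (hlt _ (Finset.mem_union_left _ h)),
    fun h => lt_irrefl _ (hlt _ (Finset.mem_union_right _ h)), fun x hx => ?_, fun x hx h => ?_⟩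
  · exact Or.inl ⟨hlt x (Finset.mem_union_left _ hx),
      Finset.dvd_prod_of_mem _ (Finset.mem_insert_of_mem hx)⟩
  · rcases h with h | h
    · obtain ⟨i, hi, hd⟩ := (hp x).prime.exists_mem_finset_dvd h.2
      have hxi : x = i := Nat.nth_injective Nat.infinite_setOfPred_prime
        ((Nat.prime_dvd_prime_iff_eq (hp x) (hp i)).mp hd)
      subst hxi
      rcases Finset.mem_insert.mp hi with rfl | hi
      · exact lt_irrefl _ (hN _ (Finset.mem_union_right _ hx))
      · exact Finset.disjoint_left.mp hUV hi hx
    · exact absurd h.1 (not_lt.mpr (hlt x (Finset.mem_union_right _ hx)).le)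

/-- Finite partial isomorphisms from `H` to `G`, as finite relations. -/
abbrev PartIso (H G : SimpleGraph ℕ) : Type :=
  {f : Finset (ℕ × ℕ) // ∀ p ∈ f, ∀ q ∈ f,
    (p.1 = q.1 ↔ p.2 = q.2) ∧ (H.Adj p.1 q.1 ↔ G.Adj p.2 q.2)}

theorem PartIso.forth {H : SimpleGraph ℕ} (f : PartIso H primeGraph) (a : ℕ) :
    ∃ g : PartIso H primeGraph, f ≤ g ∧ ∃ b, (a, b) ∈ g.1 := by
  classical
  by_cases ha : ∃ b, (a, b) ∈ f.1
  · exact ⟨f, le_rfl, ha⟩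
  obtain ⟨z, hzU, hzV, hU, hV⟩ := primeGraph_extension
    ((f.1.filter fun p => H.Adj p.1 a).image Prod.snd)
    ((f.1.filter fun p => ¬ H.Adj p.1 a).image Prod.snd) (by
      rw [Finset.disjoint_left]
      intro b h1 h2
      simp only [Finset.mem_image, Finset.mem_filter] at h1 h2
      obtain ⟨p, ⟨hp, hpa⟩, rfl⟩ := h1
      obtain ⟨q, ⟨hq, hqa⟩, hqp⟩ := h2
      exact hqa (((f.2 q hq p hp).1.mpr hqp) ▸ hpa))
  have hne : ∀ p ∈ f.1, p.2 ≠ z := by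
    intro p hp h
    by_cases hpa : H.Adj p.1 a
    · exact hzU (h ▸ Finset.mem_image_of_mem _ (Finset.mem_filter.mpr ⟨hp, hpa⟩))
    · exact hzV (h ▸ Finset.mem_image_of_mem _ (Finset.mem_filter.mpr ⟨hp, hpa⟩))
  have hne' : ∀ p ∈ f.1, p.1 ≠ a := fun p hp h => ha ⟨p.2, h ▸ hp⟩
  have hadj : ∀ p ∈ f.1, (H.Adj p.1 a ↔ primeGraph.Adj p.2 z) := by
    intro p hp
    by_cases hpa : H.Adj p.1 a
    · exact iff_of_true hpa
        (hU _ (Finset.mem_image_of_mem _ (Finset.mem_filter.mpr ⟨hp, hpa⟩)))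
    · exact iff_of_false hpa
        (hV _ (Finset.mem_image_of_mem _ (Finset.mem_filter.mpr ⟨hp, hpa⟩)))
  refine ⟨⟨insert (a, z) f.1, fun p hp q hq => ?_⟩, Finset.subset_insert _ _, z,
    Finset.mem_insert_self _ _⟩
  rcases Finset.mem_insert.mp hp with rfl | hp <;> rcases Finset.mem_insert.mp hq with rfl | hq
  · simp
  · exact ⟨iff_of_false (hne' q hq).symm (hne q hq).symm,
      by rw [H.adj_comm, primeGraph.adj_comm]; exact hadj q hq⟩
  · exact ⟨iff_of_false (hne' p hp) (hne p hp), hadj p hp⟩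
  · exact f.2 p hp q hq

/-- The inverse partial isomorphism. -/
def PartIso.inv {H G : SimpleGraph ℕ} (f : PartIso H G) : PartIso G H :=
  ⟨f.1.map (Equiv.prodComm ℕ ℕ).toEmbedding, fun p hp q hq => by
    simp only [Finset.mem_map_equiv] at hp hq
    exact ⟨(f.2 _ hp _ hq).1.symm, (f.2 _ hp _ hq).2.symm⟩⟩

theorem PartIso.back (f : PartIso primeGraph primeGraph) (b : ℕ) :
    ∃ g : PartIso primeGraph primeGraph, f ≤ g ∧ ∃ a, (a, b) ∈ g.1 := by
  obtain ⟨g, hg, a, ha⟩ := f.inv.forth b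
  refine ⟨g.inv, fun p hp => ?_, a, ?_⟩
  · have h : p.swap ∈ f.inv.1 := by
      simpa [PartIso.inv, Finset.mem_map_equiv] using hp
    simpa [PartIso.inv, Finset.mem_map_equiv] using hg h
  · simpa [PartIso.inv, Finset.mem_map_equiv] using ha

theorem isUniversalGraph_primeGraph : IsUniversalGraph primeGraph := by
  intro H
  let D : ℕ → Order.Cofinal (PartIso H primeGraph) := fun a =>
    { carrier := {g | ∃ b, (a, b) ∈ g.1}
      isCofinal := fun f => by
        obtain ⟨g, hg, h⟩ := f.forth a
        exact ⟨g, h, hg⟩ }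
  let I := Order.idealOfCofinals (⟨∅, by simp⟩ : PartIso H primeGraph) D
  have h : ∀ a, ∃ b, ∃ g ∈ I, (a, b) ∈ g.1 := fun a => by
    obtain ⟨g, ⟨b, hb⟩, hg⟩ := Order.cofinal_meets_idealOfCofinals
      (⟨∅, by simp⟩ : PartIso H primeGraph) D a
    exact ⟨b, g, hg, hb⟩
  choose e g hgI hg using h
  have key : ∀ a a', (a = a' ↔ e a = e a') ∧ (H.Adj a a' ↔ primeGraph.Adj (e a) (e a')) := by
    intro a a'
    obtain ⟨k, _, h1, h2⟩ := I.directed _ (hgI a) _ (hgI a')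
    exact k.2 (a, e a) (h1 (hg a)) (a', e a') (h2 (hg a'))
  exact ⟨⟨⟨e, fun a a' h => (key a a').1.mpr h⟩, fun {a a'} => (key a a').2.symm⟩⟩

theorem isHomogeneousGraph_primeGraph : IsHomogeneousGraph primeGraph := by
  classical
  intro A B hA f
  have := hA.fintype
  let f₀ : PartIso primeGraph primeGraph :=
    ⟨(Finset.univ : Finset A).image fun a : A => ((a : ℕ), (f a : ℕ)), by
      simp only [Finset.mem_image, Finset.mem_univ, true_and]
      rintro _ ⟨a, rfl⟩ _ ⟨a', rfl⟩
      refine ⟨?_, (f.map_rel_iff (a := a) (b := a')).symm⟩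
      rw [← Subtype.ext_iff, ← Subtype.ext_iff, f.injective.eq_iff]⟩
  let D : ℕ ⊕ ℕ → Order.Cofinal (PartIso primeGraph primeGraph) := Sum.elim
    (fun a =>
      { carrier := {g | ∃ b, (a, b) ∈ g.1}
        isCofinal := fun f => by
          obtain ⟨g, hg, h⟩ := f.forth a
          exact ⟨g, h, hg⟩ })
    (fun b =>
      { carrier := {g | ∃ a, (a, b) ∈ g.1}
        isCofinal := fun f => by
          obtain ⟨g, hg, h⟩ := f.back b
          exact ⟨g, h, hg⟩ })
  let I := Order.idealOfCofinals f₀ D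
  have h : ∀ a, ∃ b, ∃ g ∈ I, (a, b) ∈ g.1 := fun a => by
    obtain ⟨g, ⟨b, hb⟩, hg⟩ := Order.cofinal_meets_idealOfCofinals f₀ D (Sum.inl a)
    exact ⟨b, g, hg, hb⟩
  have h' : ∀ b, ∃ a, ∃ g ∈ I, (a, b) ∈ g.1 := fun b => by
    obtain ⟨g, ⟨a, ha⟩, hg⟩ := Order.cofinal_meets_idealOfCofinals f₀ D (Sum.inr b)
    exact ⟨a, g, hg, ha⟩
  have key : ∀ g ∈ I, ∀ g' ∈ I, ∀ p ∈ g.1, ∀ q ∈ g'.1,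
      (p.1 = q.1 ↔ p.2 = q.2) ∧ (primeGraph.Adj p.1 q.1 ↔ primeGraph.Adj p.2 q.2) := by
    intro g hg g' hg' p hp q hq
    obtain ⟨k, _, h1, h2⟩ := I.directed _ hg _ hg'
    exact k.2 p (h1 hp) q (h2 hq)
  choose e g hgI hg using h
  choose e' g' hgI' hg' using h'
  refine ⟨⟨⟨e, e', fun a => ?_, fun b => ?_⟩, fun {a a'} => ?_⟩, fun a => ?_⟩
  · exact (key _ (hgI' (e a)) _ (hgI a) _ (hg' (e a)) _ (hg a)).1.mpr rfl
  · exact (key _ (hgI (e' b)) _ (hgI' b) _ (hg (e' b)) _ (hg' b)).1.mp rfl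
  · exact (key _ (hgI a) _ (hgI a') _ (hg a) _ (hg a')).2.symm
  · exact (key _ (hgI a) _ (Order.mem_idealOfCofinals f₀ D) _ (hg a) (a, f a)
      (Finset.mem_image.mpr ⟨a, Finset.mem_univ a, rfl⟩)).1.mp rfl

end RandomGraphExistence

/-- The random graph exists. -/
theorem exists_isRandomGraph : ∃ G : SimpleGraph ℕ, IsRandomGraph G :=
  ⟨RandomGraphExistence.primeGraph, RandomGraphExistence.isHomogeneousGraph_primeGraph,
    RandomGraphExistence.isUniversalGraph_primeGraph⟩

open Set Topology

/-! ### Homogeneous sets of relations and covers by them -/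

/-! Fix `ι` of size `𝔥𝔪(c_max)` indexing a homogeneous cover of `prodSucc`. If the color of a pair
depends only on the states at its first difference, with finitely many states per level,
universality of `G` encodes the coloring into `c_max` (`HomCoverable.of_states`). The parity of the
first difference is such a coloring, and it is used twice.

On a compact subset of a space injecting continuously into `2^ω`, uniform continuity gives levels
such that the color of a pair split at one level is known at the next. Points of a
parity-homogeneous set never split at consecutive levels, so there the color is already known at the
split (`HomCoverable.of_tree`, `HomCoverable.of_isCompact`).

Applied to interleaved bits, parity covers `2^ω × 2^ω` by `ι` many closed graphs of functions of one
coordinate. Hence `ι` is infinite and `ι` many compact sets cover the Baire space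
(`HomCoverable.exists_compact_cover`). A Polish space, refined to inject continuously into `2^ω`, is
a continuous image of the Baire space, so it is covered by `ι` many compact sets, and `|ι|² = |ι|`
finishes. -/

/-- `H` is homogeneous for the relation `R`. -/
def RelHomogeneous {A : Type u} (R : A → A → Prop) (H : Set A) : Prop :=
  (∀ x ∈ H, ∀ y ∈ H, x ≠ y → R x y) ∨ (∀ x ∈ H, ∀ y ∈ H, x ≠ y → ¬ R x y)

/-- `S` is covered by an `ι`-indexed family of `R`-homogeneous sets. -/
def HomCoverable (ι : Type) {A : Type u} (S : Set A) (R : A → A → Prop) : Prop :=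
  ∃ H : ι → Set A, (∀ a ∈ S, ∃ i, a ∈ H i) ∧ ∀ i, RelHomogeneous R (H i)

theorem HomCoverable.pullback {ι : Type} {A : Type*} {B : Type*} {S : Set A} {T : Set B}
    {R : A → A → Prop} {R' : B → B → Prop} (h : HomCoverable ι T R') (e : A → B)
    (hmaps : MapsTo e S T)
    (he : ∀ x ∈ S, ∀ y ∈ S, x ≠ y → e x ≠ e y ∧ (R x y ↔ R' (e x) (e y))) :
    HomCoverable ι S R := by
  obtain ⟨H, hH, hom⟩ := h
  refine ⟨fun i => S ∩ e ⁻¹' H i, fun a ha => ?_, fun i => ?_⟩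
  · obtain ⟨i, hi⟩ := hH _ (hmaps ha)
    exact ⟨i, ha, hi⟩
  · refine (hom i).imp (fun h x hx y hy hxy => ?_) (fun h x hx y hy hxy => ?_)
    · have := he x hx.1 y hy.1 hxy
      exact this.2.mpr (h _ hx.2 _ hy.2 this.1)
    · have := he x hx.1 y hy.1 hxy
      exact fun hR => h _ hx.2 _ hy.2 this.1 (this.2.mp hR)

theorem HomCoverable.of_forall {ι : Type} [Infinite ι] {A : Type u} {S : Set A}
    {R : A → A → Prop} (C : ι → Set A) (hC : ∀ a ∈ S, ∃ i, a ∈ C i)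
    (h : ∀ i, HomCoverable ι (C i) R) : HomCoverable ι S R := by
  choose H hH hom using h
  obtain ⟨e⟩ : Nonempty (ι ≃ ι × ι) := by
    rw [← Cardinal.eq]
    simp [Cardinal.mul_eq_self (Cardinal.aleph0_le_mk ι)]
  refine ⟨fun i => H (e i).1 (e i).2, fun a ha => ?_, fun i => hom _ _⟩
  obtain ⟨i, hi⟩ := hC a ha
  obtain ⟨j, hj⟩ := hH i a hi
  exact ⟨e.symm (i, j), by simpa using hj⟩

/-! ### First differences -/

/-- `i` is the first index at which the state sequences of `x` and `y` differ. -/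
def IsFirstDiff {A : Type u} {V : Type*} (v : A → ℕ → V) (x y : A) (i : ℕ) : Prop :=
  (∀ k < i, v x k = v y k) ∧ v x i ≠ v y i

theorem IsFirstDiff.unique {A : Type u} {V : Type*} {v : A → ℕ → V} {x y : A} {i j : ℕ}
    (hi : IsFirstDiff v x y i) (hj : IsFirstDiff v x y j) : i = j := by
  rcases lt_trichotomy i j with h | h | h
  · exact absurd (hj.1 _ h) hi.2
  · exact h
  · exact absurd (hi.1 _ h) hj.2

theorem exists_isFirstDiff {A : Type u} {V : Type*} {v : A → ℕ → V} {x y : A}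
    (h : ∃ i, v x i ≠ v y i) : ∃ i, IsFirstDiff v x y i := by
  classical
  exact ⟨Nat.find h, fun k hk => not_not.mp (Nat.find_min h hk), Nat.find_spec h⟩

theorem IsFirstDiff.firstDiff_eq {x y : ℕ → ℕ} {i : ℕ}
    (h : IsFirstDiff (fun x : ℕ → ℕ => x) x y i) : PiNat.firstDiff x y = i := by
  have hne : x ≠ y := fun e => h.2 (by rw [e])
  exact IsFirstDiff.unique (v := fun x : ℕ → ℕ => x) (x := x) (y := y)
    ⟨fun k hk => PiNat.apply_eq_of_lt_firstDiff hk, PiNat.apply_firstDiff_ne hne⟩ h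

/-! ### Colorings reducible to `c_max` -/

/-- The relation of having color `1` under `c_random`. -/
def randomRel (G : SimpleGraph ℕ) (x y : ℕ → ℕ) : Prop :=
  G.Adj (x (PiNat.firstDiff x y)) (y (PiNat.firstDiff x y))

theorem homCoverable_prodSucc (G : SimpleGraph ℕ) :
    ∃ ι : Type, Cardinal.mk ι = PairColoring.hm (cMax G) ∧
      HomCoverable ι prodSucc (randomRel G) := by
  classical
  obtain ⟨F, hF, hU, hcard⟩ := (cMax G).exists_cover_card_eq_hm
  refine ⟨F, hcard, fun i => Subtype.val '' i.1, fun a ha => ?_, fun ⟨H, hH⟩ => ?_⟩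
  · obtain ⟨H, hH, haH⟩ : (⟨a, ha⟩ : prodSucc) ∈ ⋃₀ F := hU ▸ mem_univ _
    exact ⟨⟨H, hH⟩, ⟨a, ha⟩, haH, rfl⟩
  · obtain ⟨i, hi⟩ := hF H hH
    have key : ∀ x y : prodSucc, ∀ h : x ≠ y,
        (cMax G (PairSet.mk x y h) = 1 ↔ randomRel G x y) := by
      intro x y h
      have : cMax G (PairSet.mk x y h) = if randomRel G x y then (1 : Fin 2) else 0 := by
        unfold randomRel
        rfl
      rw [this]
      split_ifs with h' <;> simp [h']
    by_cases h1 : i = 1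
    · left
      rintro _ ⟨x, hx, rfl⟩ _ ⟨y, hy, rfl⟩ hxy
      have hne : x ≠ y := fun e => hxy (by rw [e])
      exact (key x y hne).mp (by rw [hi x hx y hy hne, h1])
    · right
      rintro _ ⟨x, hx, rfl⟩ _ ⟨y, hy, rfl⟩ hxy hR
      have hne : x ≠ y := fun e => hxy (by rw [e])
      exact h1 (by rw [← hi x hx y hy hne]; exact (key x y hne).mpr hR)

/-- Colorings decided by the states at the first difference, with finitely many states at each
level, reduce to `c_max`. -/
theorem HomCoverable.of_states {ι : Type} {G : SimpleGraph ℕ} (hG : IsUniversalGraph G)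
    (hι : HomCoverable ι prodSucc (randomRel G)) {A : Type*} {S : Set A} {R : A → A → Prop}
    {V : Type*} [Countable V] (v : A → ℕ → V) (hfin : ∀ n, ((v · n) '' S).Finite)
    (E : V → V → Prop) (hE : ∀ a b, E a b → E b a)
    (h : ∀ x ∈ S, ∀ y ∈ S, x ≠ y →
      ∃ i, IsFirstDiff v x y i ∧ (R x y ↔ E (v x i) (v y i))) :
    HomCoverable ι S R := by
  classical
  obtain ⟨enc, henc⟩ := exists_injective_nat V
  -- Removing loops loses nothing: the states at a first difference are distinct.
  let K : SimpleGraph ℕ :=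
    { Adj := fun i j => i ≠ j ∧ ∃ a b, enc a = i ∧ enc b = j ∧ E a b
      symm := ⟨fun i j ⟨hne, a, b, ha, hb, hab⟩ => ⟨hne.symm, b, a, hb, ha, hE _ _ hab⟩⟩
      loopless := ⟨fun i h => h.1 rfl⟩ }
  have hK : ∀ a b, a ≠ b → (K.Adj (enc a) (enc b) ↔ E a b) := by
    intro a b hab
    constructor
    · rintro ⟨-, a', b', ha, hb, h⟩
      rwa [henc ha, henc hb] at h
    · exact fun h => ⟨fun e => hab (henc e), a, b, rfl, rfl, h⟩
  obtain ⟨ψ⟩ := hG K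
  have hbdd : ∀ n, ∃ B, ∀ x ∈ S, ψ (enc (v x n)) ≤ B := by
    intro n
    obtain ⟨B, hB⟩ := (((hfin n).image fun a => ψ (enc a))).bddAbove
    exact ⟨B, fun x hx => hB ⟨_, ⟨x, hx, rfl⟩, rfl⟩⟩
  choose B hB using hbdd
  -- In `prodSucc` coordinate `j` allows only values up to `j`, so the state of level `n` is stored
  -- at a position `p n ≥ B n`. The padding zeros elsewhere never create a difference.
  let p : ℕ → ℕ := fun n => ∑ k ∈ Finset.range (n + 1), (B k + 1)
  have hp : StrictMono p := strictMono_nat_of_lt_succ fun n => by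
    simp only [p]
    rw [Finset.sum_range_succ _ (n + 1)]
    omega
  have hpB : ∀ n, B n ≤ p n := fun n => by
    simp only [p]
    rw [Finset.sum_range_succ]
    omega
  let e : A → ℕ → ℕ := fun x => Function.extend p (fun n => ψ (enc (v x n))) 0
  have he : ∀ x n, e x (p n) = ψ (enc (v x n)) := fun x n => hp.injective.extend_apply _ _ _
  have he' : ∀ x j, (¬ ∃ n, p n = j) → e x j = 0 := fun x j hj =>
    Function.extend_apply' _ _ _ hj
  refine hι.pullback e (fun x hx j => ?_) fun x hx y hy hxy => ?_
  · by_cases hj : ∃ n, p n = j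
    · obtain ⟨n, rfl⟩ := hj
      rw [he]
      exact Nat.lt_succ_of_le ((hB n x hx).trans (hpB n))
    · rw [he' x j hj]
      omega
  · obtain ⟨i, hi, hR⟩ := h x hx y hy hxy
    have hdiff : IsFirstDiff (fun x : ℕ → ℕ => x) (e x) (e y) (p i) := by
      refine ⟨fun k hk => ?_, ?_⟩
      · by_cases hj : ∃ n, p n = k
        · obtain ⟨n, rfl⟩ := hj
          simp only [he, hi.1 n (hp.lt_iff_lt.mp hk)]
        · simp only [he' _ _ hj]
      · simp only [he]
        exact fun heq => hi.2 (henc (ψ.injective heq))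
    refine ⟨fun heq => hdiff.2 (by rw [heq]), ?_⟩
    rw [randomRel, hdiff.firstDiff_eq, he, he, ψ.map_rel_iff, hK _ _ hi.2, hR]

/-- The coloring by the parity of the first difference. -/
def parityRel {A : Type u} {V : Type*} (v : A → ℕ → V) (x y : A) : Prop :=
  ∃ i, IsFirstDiff v x y i ∧ Even i

theorem IsFirstDiff.parityRel_iff {A : Type u} {V : Type*} {v : A → ℕ → V} {x y : A} {i : ℕ}
    (h : IsFirstDiff v x y i) : parityRel v x y ↔ Even i :=
  ⟨fun ⟨_, hj, he⟩ => h.unique hj ▸ he, fun he => ⟨i, h, he⟩⟩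

theorem homCoverable_parityRel {ι : Type} {G : SimpleGraph ℕ} (hG : IsUniversalGraph G)
    (hι : HomCoverable ι prodSucc (randomRel G)) {A : Type*} {S : Set A}
    {V : Type*} [Countable V] (v : A → ℕ → V) (hfin : ∀ n, ((v · n) '' S).Finite)
    (hsep : ∀ x ∈ S, ∀ y ∈ S, x ≠ y → ∃ i, v x i ≠ v y i) :
    HomCoverable ι S (parityRel v) := by
  -- Tagging states with their level makes the parity visible to the relation on states.
  refine hι.of_states hG (V := ℕ × V) (fun x n => (n, v x n)) (fun n => ?_)
    (fun a b => Even a.1 ∧ Even b.1) (fun a b h => h.symm) fun x hx y hy hxy => ?_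
  · exact ((finite_singleton n).prod (hfin n)).subset (by
      rintro _ ⟨x, hx, rfl⟩
      exact ⟨rfl, x, hx, rfl⟩)
  · obtain ⟨i, hi⟩ := exists_isFirstDiff (hsep x hx y hy hxy)
    refine ⟨i, ⟨fun k hk => Prod.ext rfl (hi.1 k hk), fun h => hi.2 (Prod.ext_iff.mp h).2⟩, ?_⟩
    simp [hi.parityRel_iff]

/-- If states are arranged in a tree and the color of a pair with distinct states at level `i` is
decided by the states at level `i + 1`, then the coloring reduces to `c_max`. -/
theorem HomCoverable.of_tree {ι : Type} [Infinite ι] {G : SimpleGraph ℕ}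
    (hG : IsUniversalGraph G) (hι : HomCoverable ι prodSucc (randomRel G)) {A : Type*}
    {S : Set A} {R : A → A → Prop} (hsymm : ∀ x y, R x y → R y x)
    {V : Type*} [Countable V] (v : A → ℕ → V) (hfin : ∀ n, ((v · n) '' S).Finite)
    (hsep : ∀ x ∈ S, ∀ y ∈ S, x ≠ y → ∃ i, v x i ≠ v y i)
    (htree : ∀ x y i k, k ≤ i → v x i = v y i → v x k = v y k)
    (hR : ∀ x ∈ S, ∀ y ∈ S, ∀ x' ∈ S, ∀ y' ∈ S, ∀ i, v x i ≠ v y i →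
      v x (i + 1) = v x' (i + 1) → v y (i + 1) = v y' (i + 1) → R x y → R x' y') :
    HomCoverable ι S R := by
  obtain ⟨H, hcov, hhom⟩ := homCoverable_parityRel hG hι v hfin hsep
  refine HomCoverable.of_forall (fun j => S ∩ H j)
    (fun a ha => (hcov a ha).imp fun j hj => ⟨ha, hj⟩) fun j => ?_
  -- All first differences inside `H j` have the same parity, so no two are consecutive.
  have hpar : ∀ x ∈ S ∩ H j, ∀ y ∈ S ∩ H j, ∀ z ∈ S ∩ H j, ∀ w ∈ S ∩ H j, ∀ i,
      IsFirstDiff v x y i → ¬ IsFirstDiff v z w (i + 1) := by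
    intro x hx y hy z hz w hw i h1 h2
    have hne : x ≠ y := fun e => h1.2 (by rw [e])
    have hne' : z ≠ w := fun e => h2.2 (by rw [e])
    rcases hhom j with h | h
    · have e1 := h1.parityRel_iff.mp (h x hx.2 y hy.2 hne)
      have e2 := h2.parityRel_iff.mp (h z hz.2 w hw.2 hne')
      exact (Nat.even_add_one.mp e2) e1
    · have e1 := mt h1.parityRel_iff.mpr (h x hx.2 y hy.2 hne)
      have e2 := mt h2.parityRel_iff.mpr (h z hz.2 w hw.2 hne')
      exact e2 (Nat.even_add_one.mpr e1)
  -- If some pair splits at level `i`, the level-`i` state of either member determines its level-`i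
  -- + 1` state within `H j`. By `hR` the color then depends only on the two states at the split,
  -- whichever witnesses are chosen below.
  have hext : ∀ x ∈ S ∩ H j, ∀ y ∈ S ∩ H j, ∀ x' ∈ S ∩ H j, ∀ i, IsFirstDiff v x y i →
      v x i = v x' i → v x (i + 1) = v x' (i + 1) := by
    intro x hx y hy x' hx' i hi he
    by_contra hne
    exact hpar x hx y hy x hx x' hx' i hi
      ⟨fun k hk => htree _ _ _ _ (Nat.le_of_lt_succ hk) he, hne⟩
  refine hι.of_states hG (V := ℕ × V) (fun x n => (n, v x n)) (fun n => ?_)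
    (fun s t => ∃ i, ∃ x ∈ S ∩ H j, ∃ y ∈ S ∩ H j, IsFirstDiff v x y i ∧
      s = (i, v x i) ∧ t = (i, v y i) ∧ R x y)
    ?_ fun x hx y hy hxy => ?_
  · exact ((finite_singleton n).prod (hfin n)).subset (by
      rintro _ ⟨x, hx, rfl⟩
      exact ⟨rfl, x, hx.1, rfl⟩)
  · rintro s t ⟨i, x, hx, y, hy, hi, hs, ht, hxy⟩
    exact ⟨i, y, hy, x, hx, ⟨fun k hk => (hi.1 k hk).symm, hi.2.symm⟩, ht, hs, hsymm _ _ hxy⟩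
  · obtain ⟨i, hi⟩ := exists_isFirstDiff (hsep x hx.1 y hy.1 hxy)
    refine ⟨i, ⟨fun k hk => Prod.ext rfl (hi.1 k hk), fun h => hi.2 (Prod.ext_iff.mp h).2⟩,
      fun h => ⟨i, x, hx, y, hy, hi, rfl, rfl, h⟩, ?_⟩
    rintro ⟨i', x', hx', y', hy', hi', hs, ht, h⟩
    obtain ⟨rfl, hs⟩ := Prod.ext_iff.mp hs
    obtain ⟨-, ht⟩ := Prod.ext_iff.mp ht
    dsimp only at hs ht hi'
    exact hR x' hx'.1 y' hy'.1 x hx.1 y hy.1 i hi'.2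
      (hext x' hx' y' hy' x hx i hi' hs.symm)
      (hext y' hy' x' hx' y hy i ⟨fun k hk => (hi'.1 k hk).symm, hi'.2.symm⟩ ht.symm) h

/-! ### Compact sets -/

theorem isClopen_setOf_res_eq {X : Type*} [TopologicalSpace X] {f g : X → ℕ → Bool}
    (hf : Continuous f) (hg : Continuous g) (n : ℕ) :
    IsClopen {x | PiNat.res (f x) n = PiNat.res (g x) n} := by
  induction n with
  | zero => simpa using isClopen_univ
  | succ n ih =>
    have h : IsClopen {x | f x n = g x n} :=
      (isClopen_discrete {q : Bool × Bool | q.1 = q.2}).preimage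
        (((continuous_apply n).comp hf).prodMk ((continuous_apply n).comp hg))
    convert h.inter ih using 1
    ext x
    simp

theorem res_eq_of_le {x y : ℕ → Bool} {m n : ℕ} (hmn : m ≤ n)
    (h : PiNat.res x n = PiNat.res y n) : PiNat.res x m = PiNat.res y m :=
  PiNat.res_eq_res.mpr fun _ hk => PiNat.res_eq_res.mp h (hk.trans_le hmn)

/-- A continuous coloring of a compact zero-dimensional set is uniformly continuous away from the
diagonal. -/
theorem exists_level_deciding {X : Type*} [TopologicalSpace X]
    {R : X → X → Prop} (hopen : IsOpen {q : X × X | q.1 ≠ q.2 ∧ R q.1 q.2})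
    (hopen' : IsOpen {q : X × X | q.1 ≠ q.2 ∧ ¬ R q.1 q.2}) {φ : X → ℕ → Bool}
    (hφ : Continuous φ) (hinj : Function.Injective φ) {S : Set X} (hS : IsCompact S) (n : ℕ) :
    ∃ m, ∀ x ∈ S, ∀ y ∈ S, ∀ x' ∈ S, ∀ y' ∈ S, PiNat.res (φ x) n ≠ PiNat.res (φ y) n →
      PiNat.res (φ x) m = PiNat.res (φ x') m → PiNat.res (φ y) m = PiNat.res (φ y') m →
      R x y → R x' y' := by
  have hne : ∀ x y, PiNat.res (φ x) n ≠ PiNat.res (φ y) n → x ≠ y := fun x y h e => h (by rw [e])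
  -- Away from the diagonal each color class is closed, being the complement of the other open one.
  have hZ : IsClosed {q : X × X | PiNat.res (φ q.1) n ≠ PiNat.res (φ q.2) n} :=
    (isClopen_setOf_res_eq (hφ.comp continuous_fst) (hφ.comp continuous_snd) n).compl.isClosed
  have h1 : IsClosed {q : X × X | PiNat.res (φ q.1) n ≠ PiNat.res (φ q.2) n ∧ R q.1 q.2} := by
    convert hZ.inter hopen'.isClosed_compl using 1
    ext ⟨x, y⟩
    have := hne x y
    simp only [mem_ofPred_eq, mem_inter_iff, mem_compl_iff]
    tauto
  have h2 : IsClosed {q : X × X | PiNat.res (φ q.1) n ≠ PiNat.res (φ q.2) n ∧ ¬ R q.1 q.2} := by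
    convert hZ.inter hopen.isClosed_compl using 1
    ext ⟨x, y⟩
    have := hne x y
    simp only [mem_ofPred_eq, mem_inter_iff, mem_compl_iff]
    tauto
  -- This is the compact set of pairs of differently colored pairs. Its two pairs never coincide, so
  -- the increasing open sets `O m` cover it and a single one suffices.
  have hK := ((hS.prod hS).prod (hS.prod hS)).inter_right (h1.prod h2)
  let O : ℕ → Set ((X × X) × (X × X)) := fun m =>
    {q | PiNat.res (φ q.1.1) m = PiNat.res (φ q.2.1) m ∧
      PiNat.res (φ q.1.2) m = PiNat.res (φ q.2.2) m}ᶜ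
  have hO : ∀ m, IsOpen (O m) := fun m =>
    ((isClopen_setOf_res_eq (hφ.comp (by fun_prop)) (hφ.comp (by fun_prop)) m).inter
      (isClopen_setOf_res_eq (hφ.comp (by fun_prop)) (hφ.comp (by fun_prop)) m)).compl.isOpen
  have hmono : Monotone O := fun m m' hm q hq h =>
    hq ⟨res_eq_of_le hm h.1, res_eq_of_le hm h.2⟩
  obtain ⟨m, hm⟩ := hK.elim_directed_cover O hO (by
    rintro ⟨⟨x, y⟩, x', y'⟩ ⟨-, ⟨-, hxy⟩, -, hxy'⟩
    by_contra hcon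
    simp only [O, mem_iUnion, mem_compl_iff, not_exists, not_not, mem_ofPred_eq] at hcon
    have e1 : x = x' := hinj (funext fun k => PiNat.res_eq_res.mp (hcon (k + 1)).1 k.lt_succ_self)
    have e2 : y = y' := hinj (funext fun k => PiNat.res_eq_res.mp (hcon (k + 1)).2 k.lt_succ_self)
    subst e1 e2
    exact hxy' hxy) hmono.directed_le
  -- The level must be at least `n` so that `x'` and `y'` are also separated at level `n`.
  refine ⟨max m n, fun x hx y hy x' hx' y' hy' hxy e1 e2 hR => ?_⟩
  by_contra hR'
  refine hm (a := ((x, y), (x', y'))) ⟨⟨⟨hx, hy⟩, hx', hy'⟩, ⟨hxy, hR⟩, ?_, hR'⟩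
    ⟨res_eq_of_le (le_max_left _ _) e1, res_eq_of_le (le_max_left _ _) e2⟩
  have e1' := res_eq_of_le (le_max_right m n) e1
  have e2' := res_eq_of_le (le_max_right m n) e2
  exact fun h => hxy (e1'.trans (h.trans e2'.symm))

theorem HomCoverable.of_isCompact {ι : Type} [Infinite ι] {G : SimpleGraph ℕ}
    (hG : IsUniversalGraph G) (hι : HomCoverable ι prodSucc (randomRel G))
    {X : Type*} [TopologicalSpace X]
    {R : X → X → Prop} (hsymm : ∀ x y, R x y → R y x)
    (hopen : IsOpen {q : X × X | q.1 ≠ q.2 ∧ R q.1 q.2})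
    (hopen' : IsOpen {q : X × X | q.1 ≠ q.2 ∧ ¬ R q.1 q.2}) {φ : X → ℕ → Bool}
    (hφ : Continuous φ) (hinj : Function.Injective φ) {S : Set X} (hS : IsCompact S) :
    HomCoverable ι S R := by
  choose m hm using exists_level_deciding hopen hopen' hφ hinj hS
  -- The term `m k` makes the next level decide colors; `k + 1` makes the levels unbounded, so they
  -- separate points.
  let l : ℕ → ℕ := fun i => Nat.rec 0 (fun _ k => max (k + 1) (m k)) i
  have hl : ∀ i, l (i + 1) = max (l i + 1) (m (l i)) := fun i => rfl
  have hlmono : StrictMono l := strictMono_nat_of_lt_succ fun i => by rw [hl]; omega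
  refine hι.of_tree hG hsymm (fun x i => PiNat.res (φ x) (l i)) (fun i => ?_)
    (fun x _ y _ hxy => ?_) (fun x y i k hk h => res_eq_of_le (hlmono.monotone hk) h)
    fun x hx y hy x' hx' y' hy' i hi e1 e2 => ?_
  · exact (List.finite_length_eq Bool (l i)).subset (by
      rintro _ ⟨x, -, rfl⟩
      exact PiNat.res_length _ _)
  · by_contra! hcon
    refine hxy (hinj (funext fun k => ?_))
    exact PiNat.res_eq_res.mp (hcon (k + 1)) (hlmono.id_le (k + 1))
  · have hle : m (l i) ≤ l (i + 1) := by rw [hl]; exact le_max_right _ _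
    exact hm (l i) x hx y hy x' hx' y' hy' hi (res_eq_of_le hle e1) (res_eq_of_le hle e2)

/-! ### Covering the Baire space by compact sets -/

/-- The bits of `x` and `y`, interleaved. -/
def interleave (z : (ℕ → Bool) × (ℕ → Bool)) (n : ℕ) : Bool :=
  if Even n then z.1 (n / 2) else z.2 (n / 2)

theorem continuous_interleave : Continuous interleave := by
  refine continuous_pi fun n => ?_
  unfold interleave
  split_ifs <;> fun_prop

theorem interleave_two_mul (z : (ℕ → Bool) × (ℕ → Bool)) (n : ℕ) :
    interleave z (2 * n) = z.1 n := by
  simp [interleave]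

theorem interleave_two_mul_add_one (z : (ℕ → Bool) × (ℕ → Bool)) (n : ℕ) :
    interleave z (2 * n + 1) = z.2 n := by
  have : (2 * n + 1) / 2 = n := by omega
  simp [interleave, this]

theorem interleave_injective : Function.Injective interleave := by
  intro z w h
  refine Prod.ext (funext fun n => ?_) (funext fun n => ?_)
  · rw [← interleave_two_mul, h, interleave_two_mul]
  · rw [← interleave_two_mul_add_one, h, interleave_two_mul_add_one]

theorem exists_isFirstDiff_interleave {z w : (ℕ → Bool) × (ℕ → Bool)} (h : z ≠ w) :
    ∃ i, IsFirstDiff interleave z w i :=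
  exists_isFirstDiff (Function.ne_iff.mp (interleave_injective.ne h))

theorem isOpen_setOf_isFirstDiff {A : Type*} [TopologicalSpace A] {v : A → ℕ → Bool}
    (hv : Continuous v) (i : ℕ) : IsOpen {q : A × A | IsFirstDiff v q.1 q.2 i} := by
  have h := fun i => (isClopen_discrete {q : Bool × Bool | q.1 = q.2}).preimage
    (((continuous_apply i).comp (hv.comp continuous_fst)).prodMk
      ((continuous_apply i).comp (hv.comp (continuous_snd (X := A)))))
  have : {q : A × A | IsFirstDiff v q.1 q.2 i} =
      (⋂ k ∈ Finset.range i, {q : A × A | v q.1 k = v q.2 k}) ∩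
        {q : A × A | v q.1 i = v q.2 i}ᶜ := by
    ext q
    simp [IsFirstDiff]
  rw [this]
  exact (isOpen_biInter_finset fun k _ => (h k).isOpen).inter (h i).compl.isOpen

/-- `H ×ˢ H` avoids the open set of off-diagonal pairs of the wrong color, hence so does its
closure, which is the square of the closure of `H`. -/
theorem RelHomogeneous.closure {A : Type u} [TopologicalSpace A] {R : A → A → Prop}
    (hopen : IsOpen {q : A × A | q.1 ≠ q.2 ∧ R q.1 q.2})
    (hopen' : IsOpen {q : A × A | q.1 ≠ q.2 ∧ ¬ R q.1 q.2}) {H : Set A}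
    (h : RelHomogeneous R H) : RelHomogeneous R (_root_.closure H) := by
  refine h.imp (fun h x hx y hy hxy => ?_) (fun h x hx y hy hxy => ?_)
  · have hsub : _root_.closure (H ×ˢ H) ⊆ {q : A × A | q.1 ≠ q.2 ∧ ¬ R q.1 q.2}ᶜ :=
      closure_minimal (fun q hq hq' => hq'.2 (h _ hq.1 _ hq.2 hq'.1)) hopen'.isClosed_compl
    rw [closure_prod_eq] at hsub
    by_contra hR
    exact hsub (a := (x, y)) ⟨hx, hy⟩ ⟨hxy, hR⟩
  · have hsub : _root_.closure (H ×ˢ H) ⊆ {q : A × A | q.1 ≠ q.2 ∧ R q.1 q.2}ᶜ :=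
      closure_minimal (fun q hq hq' => h _ hq.1 _ hq.2 hq'.1 hq'.2) hopen.isClosed_compl
    rw [closure_prod_eq] at hsub
    exact fun hR => hsub (a := (x, y)) ⟨hx, hy⟩ ⟨hxy, hR⟩

/-- The plane `2^ω × 2^ω` is covered by closed graphs of functions of either coordinate. -/
theorem exists_cover_by_functions {ι : Type} {G : SimpleGraph ℕ} (hG : IsUniversalGraph G)
    (hι : HomCoverable ι prodSucc (randomRel G)) :
    ∃ H : ι → Set ((ℕ → Bool) × (ℕ → Bool)), (∀ z, ∃ i, z ∈ H i) ∧ (∀ i, IsClosed (H i)) ∧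
      ∀ i, (∀ x y y', (x, y) ∈ H i → (x, y') ∈ H i → y = y') ∨
        (∀ x x' y, (x, y) ∈ H i → (x', y) ∈ H i → x = x') := by
  have hopen : IsOpen {q : ((ℕ → Bool) × (ℕ → Bool)) × ((ℕ → Bool) × (ℕ → Bool)) |
      q.1 ≠ q.2 ∧ parityRel interleave q.1 q.2} := by
    convert isOpen_biUnion (s := {i : ℕ | Even i})
      fun i _ => isOpen_setOf_isFirstDiff continuous_interleave i using 1
    ext ⟨z, w⟩
    simp only [mem_ofPred_eq, mem_iUnion, exists_prop]
    constructor
    · rintro ⟨-, i, hi, he⟩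
      exact ⟨i, he, hi⟩
    · rintro ⟨i, he, hi⟩
      exact ⟨fun e => hi.2 (by rw [e]), i, hi, he⟩
  have hopen' : IsOpen {q : ((ℕ → Bool) × (ℕ → Bool)) × ((ℕ → Bool) × (ℕ → Bool)) |
      q.1 ≠ q.2 ∧ ¬ parityRel interleave q.1 q.2} := by
    convert isOpen_biUnion (s := {i : ℕ | ¬ Even i})
      fun i _ => isOpen_setOf_isFirstDiff continuous_interleave i using 1
    ext ⟨z, w⟩
    simp only [mem_ofPred_eq, mem_iUnion, exists_prop]
    constructor
    · rintro ⟨hne, h⟩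
      obtain ⟨i, hi⟩ := exists_isFirstDiff_interleave hne
      exact ⟨i, fun he => h ⟨i, hi, he⟩, hi⟩
    · rintro ⟨i, he, hi⟩
      exact ⟨fun e => hi.2 (by rw [e]), fun h => he (hi.parityRel_iff.mp h)⟩
  obtain ⟨H, hcov, hhom⟩ := homCoverable_parityRel hG hι (S := univ) interleave
    (fun n => toFinite _) fun z _ w _ hzw => Function.ne_iff.mp (interleave_injective.ne hzw)
  refine ⟨fun i => closure (H i), fun z => (hcov z (mem_univ z)).imp fun i hi => subset_closure hi,
    fun i => isClosed_closure, fun i => ?_⟩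
  -- Points with equal first coordinates first differ at an odd index, and points with equal second
  -- coordinates at an even one.
  refine ((hhom i).closure hopen hopen').imp (fun h x y y' h1 h2 => ?_) fun h x x' y h1 h2 => ?_
  · by_contra hne
    obtain ⟨i, hi, he⟩ := h _ h1 _ h2 fun e => hne (Prod.ext_iff.mp e).2
    obtain ⟨k, rfl⟩ := even_iff_two_dvd.mp he
    exact hi.2 (by rw [interleave_two_mul, interleave_two_mul])
  · by_contra hne
    have hne' : (x, y) ≠ (x', y) := fun e => hne (Prod.ext_iff.mp e).1
    obtain ⟨i, hi⟩ := exists_isFirstDiff_interleave hne'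
    have he := mt hi.parityRel_iff.mpr (h _ h1 _ h2 hne')
    obtain ⟨k, rfl⟩ := Nat.not_even_iff_odd.mp he
    exact hi.2 (by rw [interleave_two_mul_add_one, interleave_two_mul_add_one])

/-- Finitely many homogeneous sets do not suffice. -/
theorem HomCoverable.infinite {ι : Type} {G : SimpleGraph ℕ} (hG : IsUniversalGraph G)
    (hι : HomCoverable ι prodSucc (randomRel G)) : Infinite ι := by
  classical
  obtain ⟨H, hcov, -, hfun⟩ := exists_cover_by_functions hG hι
  by_contra hfin
  rw [not_infinite_iff_finite] at hfin
  have := Fintype.ofFinite ι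
  -- Each `H i` meets a `P × P` grid in at most `|P|` points, so `|ι| < |P|` many of them cannot
  -- cover it.
  let P := Fin (Fintype.card ι + 1)
  let s : P → ℕ → Bool := fun a n => decide (n = a)
  have hs : Function.Injective s := by
    intro a b hab
    have := congrFun hab a
    simp only [s, decide_true] at this
    exact Fin.ext (of_decide_eq_true this.symm)
  choose j hj using fun q : P × P => hcov (s q.1, s q.2)
  let F : P × P → ι × P := fun q =>
    (j q, if ∀ x y y', (x, y) ∈ H (j q) → (x, y') ∈ H (j q) → y = y' then q.1 else q.2)
  have hF : Function.Injective F := by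
    rintro ⟨a, b⟩ ⟨a', b'⟩ h
    obtain ⟨h1, h2⟩ := Prod.ext_iff.mp h
    simp only [F] at h1 h2
    rw [h1] at h2
    have m1 := hj (a, b)
    have m2 := hj (a', b')
    rw [h1] at m1
    split_ifs at h2 with hc
    · subst h2
      exact Prod.ext rfl (hs (hc _ _ _ m1 m2))
    · subst h2
      exact Prod.ext (hs (((hfun _).resolve_left hc) _ _ _ m1 m2)) rfl
  have := Fintype.card_le_of_injective F hF
  simp only [Fintype.card_prod, P, Fintype.card_fin] at this
  nlinarith

/-- The gaps in the support of `x`. -/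
noncomputable def supportGaps (x : ℕ → Bool) (n : ℕ) : ℕ :=
  Nat.nth (fun k => x k = true) (n + 1) - Nat.nth (fun k => x k = true) n - 1

/-- If `p` is the position of the `n`-th one of `x`, any sequence agreeing with `x` up to and
including `p` has its `n`-th one there too. -/
theorem continuousOn_nth : ContinuousOn (fun (x : ℕ → Bool) n => Nat.nth (fun k => x k = true) n)
    {x | {k | x k = true}.Infinite} := by
  refine continuousOn_pi.mpr fun n x hx => ?_
  refine Filter.Tendsto.congr' (f₁ := fun _ => Nat.nth (fun k => x k = true) n) ?_
    tendsto_const_nhds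
  refine Filter.EventuallyEq.filter_mono ?_ nhdsWithin_le_nhds
  set p := Nat.nth (fun k => x k = true) n with hp
  have hopen : IsOpen (⋂ k ∈ Finset.range (p + 1), {y : ℕ → Bool | y k = x k}) :=
    isOpen_biInter_finset fun k _ =>
      (isOpen_discrete ({x k} : Set Bool)).preimage (continuous_apply (A := fun _ : ℕ => Bool) k)
  filter_upwards [hopen.mem_nhds (by simp)] with y hy
  simp only [mem_iInter, Finset.mem_range, mem_ofPred_eq] at hy
  have h1 : x p = true := Nat.nth_mem_of_infinite hx n
  have h2 : Nat.count (fun k => x k = true) p = n := Nat.count_nth_of_infinite hx n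
  have h3 : Nat.count (fun k => y k = true) p = n := by
    rw [← h2, Nat.count_eq_card_filter_range, Nat.count_eq_card_filter_range]
    congr 1
    refine Finset.filter_congr fun k hk => ?_
    rw [hy k (by have := Finset.mem_range.mp hk; omega)]
  rw [← h3, Nat.nth_count (p := fun k => y k = true) (by rw [hy p p.lt_succ_self]; exact h1)]

theorem continuousOn_supportGaps :
    ContinuousOn supportGaps {x | {k | x k = true}.Infinite} := by
  have h := continuousOn_pi.mp continuousOn_nth
  refine continuousOn_pi.mpr fun n => ?_
  exact (continuous_of_discreteTopology (f := fun q : ℕ × ℕ => q.1 - q.2 - 1)).comp_continuousOn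
    ((h (n + 1)).prodMk (h n))

theorem exists_supportGaps_eq (a : ℕ → ℕ) :
    ∃ x : ℕ → Bool, {k | x k = true}.Infinite ∧ supportGaps x = a := by
  classical
  let s : ℕ → ℕ := fun n => ∑ k ∈ Finset.range n, (a k + 1)
  have hsucc : ∀ n, s (n + 1) = s n + (a n + 1) := fun n => Finset.sum_range_succ _ _
  have hs : StrictMono s := strictMono_nat_of_lt_succ fun n => by rw [hsucc]; omega
  have hset : {k | decide (k ∈ range s) = true} = range s := by ext; simp
  have hinf : {k | decide (k ∈ range s) = true}.Infinite := by
    rw [hset]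
    exact infinite_range_of_injective hs.injective
  refine ⟨fun k => decide (k ∈ range s), hinf, funext fun n => ?_⟩
  have hnth : Nat.nth (fun k => decide (k ∈ range s) = true) = s := by
    rw [← StrictMono.range_inj (Nat.nth_strictMono hinf) hs, Nat.range_nth_of_infinite hinf]
    exact hset
  rw [supportGaps, hnth, hsucc]
  omega

theorem countable_setOf_not_infinite_support :
    {x : ℕ → Bool | ¬ {k | x k = true}.Infinite}.Countable := by
  have h : {s : Set ℕ | s.Finite}.Countable := by
    simpa using Set.countable_ofPred_finite_subset (countable_univ (α := ℕ))
  refine (h.preimage_of_injOn (f := fun x : ℕ → Bool => {k | x k = true}) ?_).mono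
    fun x hx => not_not.mp hx
  intro x _ y _ hxy
  funext k
  exact Bool.eq_iff_iff.mpr (Set.ext_iff.mp hxy k)

/-- `𝔡 ≤ 𝔥𝔪(c_max)`. -/
theorem HomCoverable.exists_compact_cover {ι : Type} {G : SimpleGraph ℕ} (hG : IsUniversalGraph G)
    (hι : HomCoverable ι prodSucc (randomRel G)) :
    ∃ K : ι → Set (ℕ → ℕ), (∀ i, IsCompact (K i)) ∧ ∀ a, ∃ i, a ∈ K i := by
  have hinf := hι.infinite hG
  obtain ⟨H, hcov, hclosed, hfun⟩ := exists_cover_by_functions hG hι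
  rcases le_or_gt Cardinal.continuum (Cardinal.mk ι) with hc | hc
  -- With at least continuum many indices, sets with at most one point suffice.
  · have : Cardinal.mk (ℕ → ℕ) ≤ Cardinal.mk ι := by simpa using hc
    obtain ⟨f⟩ := this
    refine ⟨fun i => f ⁻¹' {i}, fun i => Subsingleton.isCompact ?_, fun a => ⟨f a, rfl⟩⟩
    exact subsingleton_singleton.preimage f.injective
  set Q := {x : ℕ → Bool | {k | x k = true}.Infinite} with hQ
  -- These are the values at points of the countable set `Qᶜ` of those `H i` that are functions of
  -- the first coordinate. There are at most `|ι|` of them, fewer than continuum, so some `y₀` is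
  -- missed.
  let T : Set (ℕ → Bool) := {y | ∃ i : ι, ∃ q ∈ Qᶜ,
    (∀ x y y', (x, y) ∈ H i → (x, y') ∈ H i → y = y') ∧ (q, y) ∈ H i}
  obtain ⟨y₀, hy₀⟩ : ∃ y₀, y₀ ∉ T := by
    by_contra! hT
    have hQc : Countable (Qᶜ : Set (ℕ → Bool)) := countable_setOf_not_infinite_support.to_subtype
    choose i q hq hi hmem using hT
    have hinj : Function.Injective fun y => (i y, (⟨q y, hq y⟩ : (Qᶜ : Set (ℕ → Bool)))) := by
      intro y y' h
      obtain ⟨h1, h2⟩ := Prod.ext_iff.mp h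
      simp only [Subtype.mk.injEq] at h1 h2
      have m := hmem y
      rw [h1, h2] at m
      exact hi y' _ _ _ m (hmem y')
    have h1 := Cardinal.mk_le_of_injective hinj
    have h2 : Cardinal.mk (ι × (Qᶜ : Set (ℕ → Bool))) ≤ Cardinal.mk ι := by
      rw [Cardinal.mk_prod, Cardinal.lift_id, Cardinal.lift_id]
      exact Cardinal.mul_le_of_le (Cardinal.aleph0_le_mk ι) le_rfl
        ((Cardinal.mk_le_aleph0_iff.mpr hQc).trans (Cardinal.aleph0_le_mk ι))
    have h3 : Cardinal.mk (ℕ → Bool) = Cardinal.continuum := by simp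
    exact absurd (h3 ▸ h1.trans h2) (not_le.mpr hc)
  -- The section at `y₀` is either a compact subset of `Q`, by the choice of `y₀`, or has at most
  -- one point. `supportGaps` carries these pieces within `Q` onto a compact cover of the Baire
  -- space.
  let C : ι → Set (ℕ → Bool) := fun i => {x | (x, y₀) ∈ H i}
  have hC : ∀ i, IsClosed (C i) := fun i => (hclosed i).preimage (by fun_prop)
  refine ⟨fun i => supportGaps '' (C i ∩ Q), fun i => ?_, fun a => ?_⟩
  · change IsCompact (supportGaps '' (C i ∩ Q))
    by_cases h : ∀ x y y', (x, y) ∈ H i → (x, y') ∈ H i → y = y'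
    · have hsub : C i ⊆ Q := fun x hx => by
        by_contra hxQ
        exact hy₀ ⟨i, x, hxQ, h, hx⟩
      rw [inter_eq_left.mpr hsub]
      exact (hC i).isCompact.image_of_continuousOn (continuousOn_supportGaps.mono hsub)
    · refine (Subsingleton.image (fun x hx x' hx' => ?_) _).isCompact
      exact (hfun i).resolve_left h _ _ _ hx.1 hx'.1
  · obtain ⟨x, hx, rfl⟩ := exists_supportGaps_eq a
    obtain ⟨i, hi⟩ := hcov (x, y₀)
    exact ⟨i, x, ⟨hi, hx⟩, rfl⟩

/-! ### Polish spaces -/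

/-- A Polish topology has a finer Polish topology with a continuous injection into `2^ω`. -/
theorem exists_finer_polish_injection (X : Type u) [t : TopologicalSpace X] [PolishSpace X] :
    ∃ t' : TopologicalSpace X, t' ≤ t ∧ @PolishSpace X t' ∧
      ∃ φ : X → ℕ → Bool, @Continuous X (ℕ → Bool) t' _ φ ∧ Function.Injective φ := by
  classical
  obtain ⟨b, hbc, -, hb⟩ := TopologicalSpace.exists_countable_basis X
  -- Adding `∅` allows an enumeration by `ℕ` even if the basis is empty.
  obtain ⟨U, hU⟩ := (hbc.insert ∅).exists_eq_range (insert_nonempty _ _)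
  have hopen : ∀ n, IsOpen (U n) := fun n => by
    have : U n ∈ insert ∅ b := hU ▸ mem_range_self n
    rcases this with h | h
    · exact h ▸ isOpen_empty
    · exact hb.isOpen h
  have hsep : ∀ x y, x ≠ y → ∃ n, x ∈ U n ∧ y ∉ U n := by
    intro x y hne
    obtain ⟨V, hV, hxV, hyV⟩ := hb.exists_subset_of_mem_open
      (show x ∈ ({y}ᶜ : Set X) from hne) isOpen_compl_singleton
    obtain ⟨n, rfl⟩ : V ∈ range U := hU ▸ mem_insert_of_mem _ hV
    exact ⟨n, hxV, fun h => hyV h rfl⟩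
  -- Every `U n` becomes clopen in a common finer Polish topology, so the membership bits are
  -- continuous; they separate points because the `U n` include a basis.
  choose m hmt hm hclosed hop using fun n => (hopen n).isClopenable
  obtain ⟨t', ht'm, ht't, ht'⟩ := PolishSpace.exists_polishSpace_forall_le m hmt hm
  refine ⟨t', ht't, ht', fun x n => decide (x ∈ U n), ?_, fun x y hxy => ?_⟩
  · let := t'
    refine continuous_pi fun n => ?_
    have hcl : IsClopen (U n) := ⟨(hclosed n).mono (ht'm n), ht'm n _ (hop n)⟩
    refine (IsLocallyConstant.iff_exists_open _).mpr (fun x => ?_) |>.continuous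
    by_cases hx : x ∈ U n
    · exact ⟨U n, hcl.isOpen, hx, fun y hy => by simp [hx, hy]⟩
    · exact ⟨(U n)ᶜ, hcl.compl.isOpen, hx, fun y hy => by
        have : y ∉ U n := hy
        simp [hx, this]⟩
  · by_contra hne
    obtain ⟨n, hx, hy⟩ := hsep x y hne
    have := congrFun hxy n
    simp [hx, hy] at this

theorem HomCoverable.of_polishSpace {ι : Type} {G : SimpleGraph ℕ} (hG : IsUniversalGraph G)
    (hι : HomCoverable ι prodSucc (randomRel G))
    {X : Type u} [TopologicalSpace X] [PolishSpace X]
    {R : X → X → Prop} (hsymm : ∀ x y, R x y → R y x)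
    (hopen : IsOpen {q : X × X | q.1 ≠ q.2 ∧ R q.1 q.2})
    (hopen' : IsOpen {q : X × X | q.1 ≠ q.2 ∧ ¬ R q.1 q.2}) {φ : X → ℕ → Bool}
    (hφ : Continuous φ) (hinj : Function.Injective φ) :
    HomCoverable ι (univ : Set X) R := by
  have := hι.infinite hG
  rcases isEmpty_or_nonempty X with hX | hX
  · exact ⟨fun _ => ∅, fun a => hX.elim a, fun _ => Or.inl fun x hx => hx.elim⟩
  obtain ⟨K, hK, hcov⟩ := hι.exists_compact_cover hG
  obtain ⟨f, hf, hsurj⟩ := PolishSpace.exists_nat_nat_continuous_surjective X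
  refine HomCoverable.of_forall (fun i => f '' K i) (fun a _ => ?_) fun i =>
    HomCoverable.of_isCompact hG hι hsymm hopen hopen' hφ hinj ((hK i).image hf)
  obtain ⟨b, rfl⟩ := hsurj a
  exact (hcov b).imp fun i hi => mem_image_of_mem f hi

/-! ### Continuous pair-colorings -/

namespace PairColoring

variable {X : Type u}

/-- The relation of having color `1` under `c`. -/
def rel (c : PairColoring X) (x y : X) : Prop := ∃ h : x ≠ y, c (PairSet.mk x y h) = 1

theorem rel_symm (c : PairColoring X) {x y : X} (h : c.rel x y) : c.rel y x := by
  obtain ⟨hne, h⟩ := h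
  refine ⟨hne.symm, ?_⟩
  rw [← h]
  exact congrArg c (Subtype.ext Sym2.eq_swap)

/-- Continuity on the quotient lifts to the off-diagonal part of `X × X`, which is open as `X` is
Hausdorff. -/
theorem isOpen_setOf_color [TopologicalSpace X] [T2Space X] {c : PairColoring X}
    (hc : Continuous c) (T : Set (Fin 2)) :
    IsOpen {q : X × X | ∃ h : q.1 ≠ q.2, c (PairSet.mk q.1 q.2 h) ∈ T} := by
  have hcont : Continuous
      fun q : {q : X × X // q.1 ≠ q.2} => c (PairSet.mk q.1.1 q.1.2 q.2) :=
    hc.comp continuous_coinduced_rng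
  have hne : IsOpen {q : X × X | q.1 ≠ q.2} := isOpen_ne_fun continuous_fst continuous_snd
  convert hne.isOpenMap_subtype_val _ ((isOpen_discrete T).preimage hcont) using 1
  ext q
  constructor
  · rintro ⟨h, hT⟩
    exact ⟨⟨q, h⟩, hT, rfl⟩
  · rintro ⟨⟨q, h⟩, hT, rfl⟩
    exact ⟨h, hT⟩

theorem isOpen_rel [TopologicalSpace X] [T2Space X] {c : PairColoring X} (hc : Continuous c) :
    IsOpen {q : X × X | q.1 ≠ q.2 ∧ c.rel q.1 q.2} := by
  convert isOpen_setOf_color hc {1} using 1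
  ext q
  exact ⟨fun h => h.2, fun h => ⟨h.1, h⟩⟩

theorem isOpen_not_rel [TopologicalSpace X] [T2Space X] {c : PairColoring X}
    (hc : Continuous c) : IsOpen {q : X × X | q.1 ≠ q.2 ∧ ¬ c.rel q.1 q.2} := by
  convert isOpen_setOf_color hc {1}ᶜ using 1
  ext q
  exact ⟨fun h => ⟨h.1, fun h' => h.2 ⟨h.1, h'⟩⟩, fun h => ⟨h.1, fun h' => h.2 h'.2⟩⟩

theorem hm_le_of_homCoverable (c : PairColoring X) {ι : Type}
    (h : HomCoverable ι (univ : Set X) c.rel) : c.hm ≤ Cardinal.lift.{u} (Cardinal.mk ι) := by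
  obtain ⟨H, hcov, hhom⟩ := h
  have hle : c.hm ≤ Cardinal.mk (range H) := by
    refine csInf_le' ⟨range H, ?_, ?_, rfl⟩
    · rintro _ ⟨i, rfl⟩
      rcases hhom i with h | h
      · exact ⟨1, fun x hx y hy hne => (h x hx y hy hne).2⟩
      · refine ⟨0, fun x hx y hy hne => ?_⟩
        have h1 : c (PairSet.mk x y hne) ≠ 1 := fun h' => h x hx y hy hne ⟨hne, h'⟩
        omega
    · refine eq_univ_of_forall fun x => ?_
      obtain ⟨i, hi⟩ := hcov x (mem_univ x)
      exact ⟨H i, mem_range_self i, hi⟩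
  have := Cardinal.mk_range_le_lift (f := H)
  rw [Cardinal.lift_uzero] at this
  exact hle.trans this

end PairColoring

/-- Ensures that the color classes stay open when the topology of `X` is refined. -/
theorem prod_topology_mono {X : Type u} {t' t : TopologicalSpace X} (h : t' ≤ t) :
    @instTopologicalSpaceProd X X t' t' ≤ @instTopologicalSpaceProd X X t t :=
  inf_le_inf (induced_mono h) (induced_mono h)

theorem mainTheorem3 (G : SimpleGraph ℕ) (hG : IsRandomGraph G)
    (X : Type u) [TopologicalSpace X] [PolishSpace X]
    (c : PairColoring X) (hc : Continuous c) :
    PairColoring.hm c ≤ Cardinal.lift.{u} (PairColoring.hm (cMax G)) := by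
  obtain ⟨ι, hcard, hι⟩ := homCoverable_prodSucc G
  rw [← hcard]
  refine c.hm_le_of_homCoverable ?_
  have hopen := PairColoring.isOpen_rel hc
  have hopen' := PairColoring.isOpen_not_rel hc
  obtain ⟨t', hle, hpol, φ, hφ, hinj⟩ := exists_finer_polish_injection X
  exact @HomCoverable.of_polishSpace ι G hG.universal hι X t' hpol c.rel (fun _ _ => c.rel_symm)
    (prod_topology_mono hle _ hopen) (prod_topology_mono hle _ hopen') φ hφ hinj
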